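/- For $n\ge 3$ and $k=1,\dots,n$ let $a_{k;n}=(\cos(k\pi/n),\sin(k\pi/n))^T\in\mathbb{R}^2$ and $A_k=a_{k;n}a_{k;n}^T$. Let $$\lambda(n)=-\,{}_3F_2\!\left[\begin{matrix}1,\ -\tfrac n2+\tfrac12,\ -\tfrac n2\\ \tfrac12,\ -n+1\end{matrix};1\right]=-\sum_{k=0}^{\lfloor n/2\rfloor}\frac{(1)_k\,(-\tfrac n2+\tfrac12)_k\,(-\tfrac n2)_k}{(\tfrac12)_k\,(-n+1)_k\,k!},\qquad (a)_k=a(a+1)\cdots(a+k-1).$$ Then for every $n\ge 3$ $$\frac1{n!}\sum_{\sigma\in S_n}A_{\sigma(1)}A_{\sigma(2)}\cdots A_{\sigma(n)}=-\lambda(n)\,2^{-n}I,\qquad 0\le\lambda(n)\le 1,$$ and $\lambda(n)=O(1/n)$ as $n\to\infty$. Consequently the symmetrized product satisfies the noncommutative arithmetic–geometric mean inequality in operator norm, $$\Big\|\frac1{n!}\sum_{\sigma\in S_n}A_{\sigma(1)}\cdots A_{\sigma(n)}\Big\|\le\Big\|\Big(\frac1n\sum_{k=1}^nA_k\Big)^n\Big\|\qquad(n\ge3),$$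 with an asymptotic gap: as $n\to\infty$, the left side is $O(1/n)$ times the right side. -/

import Mathlib

noncomputable section

namespace HarmonicFrame

/-- The generalized hypergeometric series with upper parameters `a₁, a₂, a₃`, lower parameters
`b₁, b₂` and argument `z`, i.e. `∑ (a₁)ₖ (a₂)ₖ (a₃)ₖ / ((b₁)ₖ (b₂)ₖ) * zᵏ / k!` with rising
factorials `(a)ₖ = a (a + 1) ⋯ (a + k - 1)`. When an upper parameter is a non-positive integer
`-m`, every term with `k > m` is `0`: the series terminates, also when a lower parameter is an
integer smaller than `-m`. -/
def hypergeom (a₁ a₂ a₃ b₁ b₂ z : ℝ) : ℝ :=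
  ∑' k : ℕ, ((ascPochhammer ℝ k).eval a₁ * (ascPochhammer ℝ k).eval a₂ *
      (ascPochhammer ℝ k).eval a₃) /
    ((ascPochhammer ℝ k).eval b₁ * (ascPochhammer ℝ k).eval b₂) * (z ^ k / (k.factorial : ℝ))

/-- The number `λ(n)`; the series terminates after the term `k = ⌊n / 2⌋`. -/
def lam (n : ℕ) : ℝ :=
  -hypergeom 1 (-(n : ℝ) / 2 + 1 / 2) (-(n : ℝ) / 2) (1 / 2) (-(n : ℝ) + 1) 1

/-- The frame vector `(cos (k π / n), sin (k π / n))`. -/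
def frameVec (n k : ℕ) : Fin 2 → ℝ :=
  ![Real.cos (k * (Real.pi / n)), Real.sin (k * (Real.pi / n))]

/-- The rank-one matrix `A_k = a_k a_kᵀ`. -/
def frameMat (n k : ℕ) : Matrix (Fin 2) (Fin 2) ℝ :=
  Matrix.vecMulVec (frameVec n k) (frameVec n k)

/-- The symmetrized geometric mean `(1 / n!) ∑_σ A_{σ(1)} A_{σ(2)} ⋯ A_{σ(n)}`. The element
`i : Fin n` stands for the index `i + 1 ∈ {1, …, n}`. -/
def symmGeomMean (n : ℕ) : Matrix (Fin 2) (Fin 2) ℝ :=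
  (1 / (n.factorial : ℝ)) •
    ∑ σ : Equiv.Perm (Fin n), (List.ofFn fun i : Fin n => frameMat n ((σ i : ℕ) + 1)).prod

/-- The arithmetic mean `(1 / n) (A_1 + ⋯ + A_n)`. -/
def arithMean (n : ℕ) : Matrix (Fin 2) (Fin 2) ℝ :=
  (1 / (n : ℝ)) • ∑ k ∈ Finset.Icc 1 n, frameMat n k

/-- The operator norm of a matrix acting on the Euclidean plane. -/
def opNorm (M : Matrix (Fin 2) (Fin 2) ℝ) : ℝ :=
  ‖Matrix.toEuclideanCLM (n := Fin 2) (𝕜 := ℝ) M‖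

end HarmonicFrame

end

namespace HarmonicFrame

open Finset

/-! By the double-angle formulas `2 A_k = I + T_k` with `T_k` symmetric and traceless, and such `T`
satisfy `T ^ 2 = (p ^ 2 + q ^ 2) I`. Polarization writes the symmetrized product as an alternating
sum of `n`-th powers of partial sums `z I + T(p, q)`; expanding each power leaves a scalar even part
and an odd multiple of `T(p, q)`. Only alternating moments of the numbers `z`, `p + iq`, `p - iq`
remain, the last two being partial sums of powers of `ζ` and `ζ⁻¹` for `ζ = exp(2πi/n)`. Read
backwards, commutative polarization makes these moments coefficients of `∏ (1 + ζ ^ k x + ζ ^ (-k)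
y)`. This product contains only powers of `xy` and the monomials `x ^ n`, `y ^ n`
(`prod_one_add_root_add_inv`), so the odd part vanishes and the even part sums to the series for
`-λ(n)`. The bounds follow from the recurrence `2n λ(n+1) = (n+1) λ(n) + 2` (`lam_succ`), obtained
by telescoping, with `λ(3) = 1/2`. -/

/-! ### Polarization -/

/-- Polarization: the symmetrized product of a family in a ring is an alternating sum of powers of
partial sums. -/
theorem sum_perm_prod_ofFn {R : Type*} [Ring R] {n : ℕ} (v : Fin n → R) :
    ∑ σ : Equiv.Perm (Fin n), (List.ofFn fun i => v (σ i)).prod =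
      ∑ U : Finset (Fin n), (-1) ^ #U * (∑ k ∈ Uᶜ, v k) ^ n := by
  have hpow (U : Finset (Fin n)) : (∑ k ∈ Uᶜ, v k) ^ n =
      ∑ r : Fin n → Fin n, if U ⊆ (univ.image r)ᶜ then (List.ofFn fun i => v (r i)).prod else 0 := by
    have h := (MultilinearMap.mkPiAlgebraFin ℤ n R).map_sum_finset
      (fun _ : Fin n => v) (fun _ => Uᶜ)
    rw [MultilinearMap.mkPiAlgebraFin_apply_const] at h
    rw [h, ← sum_filter]
    refine sum_congr ?_ fun r _ => by rw [MultilinearMap.mkPiAlgebraFin_apply]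
    ext r
    simp only [Fintype.mem_piFinset, mem_compl, mem_filter, mem_univ, true_and]
    refine ⟨fun h k hk => ?_, fun h i hi => ?_⟩
    · simp only [mem_compl, mem_image, mem_univ, true_and, not_exists]
      rintro i rfl
      exact h i hk
    · have := h hi
      simp at this
  simp_rw [hpow, mul_sum]
  rw [sum_comm]
  -- Inclusion–exclusion: the signs cancel unless the complement of the image of `r` is empty, that
  -- is, unless `r` is a permutation.
  have hin (r : Fin n → Fin n) :
      ∑ U : Finset (Fin n), (-1 : R) ^ #U *
        (if U ⊆ (univ.image r)ᶜ then (List.ofFn fun i => v (r i)).prod else 0) =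
      if Function.Bijective r then (List.ofFn fun i => v (r i)).prod else 0 := by
    simp_rw [mul_ite, mul_zero]
    rw [← sum_filter, ← sum_mul]
    have hf : univ.filter (fun U : Finset (Fin n) => U ⊆ (univ.image r)ᶜ) =
        ((univ.image r)ᶜ).powerset := by
      ext; simp
    have hs : (∑ U ∈ ((univ.image r)ᶜ).powerset, (-1 : R) ^ #U) =
        ((∑ U ∈ ((univ.image r)ᶜ).powerset, (-1 : ℤ) ^ #U : ℤ) : R) := by push_cast; rfl
    rw [hf, hs, sum_powerset_neg_one_pow_card]
    have hb : (univ.image r)ᶜ = ∅ ↔ Function.Bijective r := by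
      rw [compl_eq_empty_iff, ← Finite.surjective_iff_bijective, eq_univ_iff_forall]
      simp [Function.Surjective]
    simp only [hb]
    split_ifs <;> simp
  simp_rw [hin]
  rw [← sum_filter]
  refine sum_bij (fun σ _ => (σ : Fin n → Fin n)) (fun σ _ => mem_filter.2 ⟨mem_univ _, σ.bijective⟩)
    (fun _ _ _ _ h => DFunLike.coe_injective h) (fun r hr => ?_) (fun _ _ => rfl)
  exact ⟨Equiv.ofBijective r (by simpa using hr), mem_univ _, rfl⟩

/-- Polarization in a commutative ring. -/
theorem factorial_mul_prod {R : Type*} [CommRing R] {n : ℕ} (v : Fin n → R) :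
    (n.factorial : R) * ∏ i, v i =
      ∑ U : Finset (Fin n), (-1) ^ #U * (∑ k ∈ Uᶜ, v k) ^ n := by
  rw [← sum_perm_prod_ofFn]
  have h (σ : Equiv.Perm (Fin n)) : (List.ofFn fun i => v (σ i)).prod = ∏ i, v i := by
    rw [List.prod_ofFn, Equiv.prod_comp σ v]
  simp [h, Fintype.card_perm]

/-! ### Products over roots of unity and Lucas-type coefficients -/

theorem prod_one_sub_mul_pow {ζ : ℂ} {n : ℕ} (hn : 0 < n) (h : IsPrimitiveRoot ζ n) (u : ℂ) :
    ∏ i : Fin n, (1 - u * ζ ^ ((i : ℕ) + 1)) = 1 - u ^ n := by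
  have h1 : (u * ζ) ^ n = u ^ n := by rw [mul_pow, h.pow_eq_one, mul_one]
  have h2 := congrArg (Polynomial.eval 1) (X_pow_sub_C_eq_prod h hn h1)
  rw [Polynomial.eval_prod] at h2
  simp only [Polynomial.eval_sub, Polynomial.eval_pow, Polynomial.eval_X, Polynomial.eval_C,
    one_pow] at h2
  rw [h2, ← Fin.prod_univ_eq_prod_range (fun i => 1 - ζ ^ i * (u * ζ)) n]
  exact prod_congr rfl fun i _ => by ring

/-- The coefficient of `sʲ` in the polynomial expressing `cⁿ + (1 - c)ⁿ` through `s = c (1 - c)`. -/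
noncomputable def lucasCoeff (n j : ℕ) : ℝ :=
  if 2 * j ≤ n then
    (-1) ^ j * n * (n - 1 - j).factorial / ((n - 2 * j).factorial * j.factorial) else 0

theorem lucasCoeff_of_lt {n j : ℕ} (h : n < 2 * j) : lucasCoeff n j = 0 :=
  if_neg (by omega)

theorem lucasCoeff_zero {n : ℕ} (hn : 1 ≤ n) : lucasCoeff n 0 = 1 := by
  obtain ⟨m, rfl⟩ := Nat.exists_eq_add_of_le' hn
  have h : ((m : ℝ) + 1) * m.factorial ≠ 0 := by positivity
  simpa [lucasCoeff, Nat.factorial_succ] using div_self h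

/-- Coefficient form of `P_{n+2} = P_{n+1} - s P_n` for `P_n = c ^ n + (1 - c) ^ n`, `s = c (1 -
c)`. It fails at `n = 0`, where `lucasCoeff 0 0 = 0` although `P_0 = 2`. -/
theorem lucasCoeff_succ {n : ℕ} (hn : 1 ≤ n) (j : ℕ) :
    lucasCoeff (n + 2) (j + 1) = lucasCoeff (n + 1) (j + 1) - lucasCoeff n j := by
  rcases lt_trichotomy n (2 * j) with h | rfl | h
  · simp [lucasCoeff_of_lt h, lucasCoeff_of_lt (show n + 2 < 2 * (j + 1) by omega),
      lucasCoeff_of_lt (show n + 1 < 2 * (j + 1) by omega)]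
  · obtain ⟨m, rfl⟩ := Nat.exists_eq_add_of_le' (show 1 ≤ j by omega)
    rw [lucasCoeff_of_lt (show 2 * (m + 1) + 1 < 2 * (m + 1 + 1) by omega), lucasCoeff, lucasCoeff,
      if_pos (by omega), if_pos (by omega),
      show 2 * (m + 1) + 2 - 1 - (m + 1 + 1) = m + 1 by omega,
      show 2 * (m + 1) - 1 - (m + 1) = m by omega,
      show 2 * (m + 1) + 2 - 2 * (m + 1 + 1) = 0 by omega, Nat.sub_self]
    have := Nat.factorial_ne_zero m
    simp only [Nat.factorial_succ, Nat.factorial_zero]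
    push_cast
    field_simp
    ring
  · obtain ⟨r, rfl⟩ := Nat.exists_eq_add_of_lt h
    rw [lucasCoeff, lucasCoeff, lucasCoeff, if_pos (by omega), if_pos (by omega),
      if_pos (by omega),
      show 2 * j + r + 1 + 2 - 1 - (j + 1) = (j + r) + 1 by omega,
      show 2 * j + r + 1 + 2 - 2 * (j + 1) = r + 1 by omega,
      show 2 * j + r + 1 + 1 - 1 - (j + 1) = j + r by omega,
      show 2 * j + r + 1 + 1 - 2 * (j + 1) = r by omega,
      show 2 * j + r + 1 - 1 - j = j + r by omega,
      show 2 * j + r + 1 - 2 * j = r + 1 by omega]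
    have := Nat.factorial_ne_zero j
    have := Nat.factorial_ne_zero r
    simp only [Nat.factorial_succ]
    push_cast
    field_simp
    ring

/-- Two consecutive exponents are carried because the recurrence has order two. The cutoff `N` stays
free since the step needs the two earlier sums at different lengths. -/
theorem sum_lucasCoeff_mul_pow_aux (c : ℂ) (n : ℕ) :
    (∀ N, n + 1 < 2 * N → ∑ j ∈ range N, (lucasCoeff (n + 1) j : ℂ) * (c * (1 - c)) ^ j =
      c ^ (n + 1) + (1 - c) ^ (n + 1)) ∧
    (∀ N, n + 2 < 2 * N → ∑ j ∈ range N, (lucasCoeff (n + 2) j : ℂ) * (c * (1 - c)) ^ j =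
      c ^ (n + 2) + (1 - c) ^ (n + 2)) := by
  induction n with
  | zero =>
    refine ⟨fun N hN => ?_, fun N hN => ?_⟩
    · obtain ⟨M, rfl⟩ := Nat.exists_eq_add_of_le' (show 1 ≤ N by omega)
      rw [sum_range_succ', sum_eq_zero fun j _ => by rw [lucasCoeff_of_lt (by omega)]; simp]
      rw [lucasCoeff_zero (by omega)]
      simp
    · obtain ⟨M, rfl⟩ := Nat.exists_eq_add_of_le' (show 2 ≤ N by omega)
      rw [sum_range_succ', sum_range_succ',
        sum_eq_zero fun j _ => by rw [lucasCoeff_of_lt (by omega)]; simp]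
      rw [lucasCoeff_zero (by omega)]
      simp [lucasCoeff]
      ring
  | succ n ih =>
    refine ⟨ih.2, fun N hN => ?_⟩
    obtain ⟨M, rfl⟩ := Nat.exists_eq_add_of_le' (show 1 ≤ N by omega)
    have h1 := ih.1 M (by omega)
    have h2 := ih.2 (M + 1) (by omega)
    rw [sum_range_succ', lucasCoeff_zero (by omega)] at h2 ⊢
    have h3 : ∀ j, (lucasCoeff (n + 1 + 2) (j + 1) : ℂ) * (c * (1 - c)) ^ (j + 1) =
        (lucasCoeff (n + 2) (j + 1) : ℂ) * (c * (1 - c)) ^ (j + 1) -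
        (c * (1 - c)) * ((lucasCoeff (n + 1) j : ℂ) * (c * (1 - c)) ^ j) := by
      intro j
      rw [lucasCoeff_succ (by omega)]
      push_cast
      ring
    simp_rw [h3]
    rw [sum_sub_distrib, ← mul_sum, h1, sub_add_eq_add_sub, h2]
    ring

theorem sum_lucasCoeff_mul_pow (c : ℂ) {n : ℕ} (hn : 1 ≤ n) :
    ∑ j ∈ range (n + 1), (lucasCoeff n j : ℂ) * (c * (1 - c)) ^ j = c ^ n + (1 - c) ^ n := by
  obtain ⟨m, rfl⟩ := Nat.exists_eq_add_of_le' hn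
  exact (sum_lucasCoeff_mul_pow_aux c m).1 _ (by omega)

/-- If `c (1 - c) = ξη`, each factor splits as `c (1 + ξw/c)(1 + ηw⁻¹/c)` with `w` a power of `ζ`,
and each resulting product over the roots of unity is a binomial. Multiplying out gives `c ^ n + (1
- c) ^ n - (-ξ) ^ n - (-η) ^ n`. -/
theorem prod_one_add_root_add_inv {ζ : ℂ} {n : ℕ} (hn : 1 ≤ n) (h : IsPrimitiveRoot ζ n)
    (ξ η : ℂ) :
    ∏ i : Fin n, (1 + ζ ^ ((i : ℕ) + 1) * ξ + (ζ⁻¹) ^ ((i : ℕ) + 1) * η) =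
      ∑ j ∈ range (n + 1), (lucasCoeff n j : ℂ) * (ξ * η) ^ j - (-ξ) ^ n - (-η) ^ n := by
  -- The roots of `c ^ 2 - c + ξη` sum to `1`, so one of them is nonzero.
  obtain ⟨c, hc0, hc⟩ : ∃ c : ℂ, c ≠ 0 ∧ c * (1 - c) = ξ * η := by
    obtain ⟨d, hd⟩ := IsAlgClosed.exists_pow_nat_eq (1 - 4 * (ξ * η)) two_pos
    by_cases h1 : 1 + d = 0
    · exact ⟨(1 - d) / 2, by rw [eq_neg_of_add_eq_zero_right h1]; norm_num, by linear_combination -hd / 4⟩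
    · exact ⟨(1 + d) / 2, div_ne_zero h1 two_ne_zero, by linear_combination -hd / 4⟩
  have hζ : ζ ≠ 0 := h.ne_zero (by omega)
  have hfac (i : Fin n) : 1 + ζ ^ ((i : ℕ) + 1) * ξ + (ζ⁻¹) ^ ((i : ℕ) + 1) * η =
      c * ((1 - (-ξ / c) * ζ ^ ((i : ℕ) + 1)) * (1 - (-η / c) * (ζ⁻¹) ^ ((i : ℕ) + 1))) := by
    have hz : ζ ^ ((i : ℕ) + 1) ≠ 0 := pow_ne_zero _ hζ
    rw [inv_pow]
    generalize ζ ^ ((i : ℕ) + 1) = w at hz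
    field_simp
    linear_combination w * hc
  rw [prod_congr rfl fun i _ => hfac i, prod_mul_distrib, prod_mul_distrib,
    prod_one_sub_mul_pow hn h, prod_one_sub_mul_pow hn h.inv, ← hc, sum_lucasCoeff_mul_pow c hn]
  have h1c : (1 - c) ^ n = (-ξ) ^ n * (-η) ^ n / c ^ n := by
    rw [← mul_pow, ← div_pow]
    congr 1
    field_simp
    linear_combination hc
  have hcn : c ^ n ≠ 0 := pow_ne_zero _ hc0
  rw [h1c, prod_const, card_univ, Fintype.card_fin, div_pow, div_pow]
  field_simp
  ring

/-! ### Alternating moments as polynomial coefficients -/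

open MvPolynomial in
theorem coeff_trinomial_pow (x y z : ℂ) (n a b : ℕ) :
    coeff (Finsupp.single (0 : Fin 2) a + Finsupp.single 1 b)
      ((C z + C x * X 0 + C y * X 1) ^ n : MvPolynomial (Fin 2) ℂ) =
      (n.choose a * (n - a).choose b : ℕ) * (z ^ (n - a - b) * x ^ a * y ^ b) := by
  have hinj (m l : ℕ) : (Finsupp.single (0 : Fin 2) m + Finsupp.single 1 l =
      Finsupp.single (0 : Fin 2) a + Finsupp.single 1 b) ↔ a = m ∧ b = l := by
    refine ⟨fun h => ?_, by rintro ⟨rfl, rfl⟩; rfl⟩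
    have h0 := DFunLike.congr_fun h 0
    have h1 := DFunLike.congr_fun h 1
    simp at h0 h1
    exact ⟨h0.symm, h1.symm⟩
  have hexp : ((C z + C x * X 0 + C y * X 1) ^ n : MvPolynomial (Fin 2) ℂ) =
      ∑ m ∈ range (n + 1), ∑ l ∈ range (n - m + 1),
        monomial (Finsupp.single (0 : Fin 2) m + Finsupp.single 1 l)
          (((n.choose m * (n - m).choose l : ℕ) : ℂ) * (z ^ (n - m - l) * x ^ m * y ^ l)) := by
    rw [show (C z + C x * X 0 + C y * X 1 : MvPolynomial (Fin 2) ℂ) =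
      C x * X 0 + (C y * X 1 + C z) by ring, add_pow]
    refine sum_congr rfl fun m _ => ?_
    rw [add_pow, mul_sum, sum_mul]
    refine sum_congr rfl fun l _ => ?_
    rw [monomial_eq, Finsupp.prod_add_index' (by simp) (by intros; exact pow_add _ _ _),
      Finsupp.prod_single_index (by simp), Finsupp.prod_single_index (by simp)]
    simp only [map_mul, map_pow, map_natCast, Nat.cast_mul]
    ring
  rw [hexp]
  simp only [coeff_sum, coeff_monomial, hinj]
  simp only [ite_and, sum_ite_irrel, sum_const_zero, sum_ite_eq, mem_range]
  split_ifs with h1 h2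
  · rfl
  · rw [Nat.choose_eq_zero_of_lt (show n - a < b by omega)]; simp
  · rw [Nat.choose_eq_zero_of_lt (show n < a by omega)]; simp

open MvPolynomial in
theorem prod_one_add_root_add_inv_X {ζ : ℂ} {n : ℕ} (hn : 1 ≤ n) (h : IsPrimitiveRoot ζ n) :
    ∏ i : Fin n, (C 1 + C (ζ ^ ((i : ℕ) + 1)) * X 0 + C ((ζ⁻¹) ^ ((i : ℕ) + 1)) * X 1 :
      MvPolynomial (Fin 2) ℂ) =
      ∑ j ∈ range (n + 1),
        monomial (Finsupp.single (0 : Fin 2) j + Finsupp.single 1 j) (lucasCoeff n j : ℂ) -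
      monomial (Finsupp.single 0 n) ((-1) ^ n) - monomial (Finsupp.single 1 n) ((-1) ^ n) := by
  apply MvPolynomial.funext
  intro v
  have := prod_one_add_root_add_inv hn h (v 0) (v 1)
  simp only [map_prod, map_sum, map_sub, map_add, map_mul, eval_C, eval_X, eval_monomial]
  rw [this]
  have h1 (j : ℕ) : (Finsupp.single (0 : Fin 2) j + Finsupp.single 1 j).prod
      (fun n e => v n ^ e) = (v 0 * v 1) ^ j := by
    rw [Finsupp.prod_add_index' (by simp) (by intros; exact pow_add _ _ _),
      Finsupp.prod_single_index (by simp), Finsupp.prod_single_index (by simp), mul_pow]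
  simp only [h1]
  rw [Finsupp.prod_single_index (by simp), Finsupp.prod_single_index (by simp), neg_pow (v 0),
    neg_pow (v 1)]

/-- The alternating sum over subsets of the mixed moments of the partial sums of the powers
of `ζ`. -/
noncomputable def altMoment (ζ : ℂ) (n a b : ℕ) : ℂ :=
  ∑ U : Finset (Fin n), (-1) ^ #U * ((#Uᶜ : ℂ) ^ (n - a - b) *
    (∑ k ∈ Uᶜ, ζ ^ ((k : ℕ) + 1)) ^ a * (∑ k ∈ Uᶜ, (ζ⁻¹) ^ ((k : ℕ) + 1)) ^ b)

-- Polarizing `n!` times the product turns each subset `U` into a trinomial power, whose `x ^ a y ^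
-- b` coefficient is the summand of `altMoment` times the binomials.
open MvPolynomial in
theorem choose_mul_altMoment {ζ : ℂ} {n : ℕ} (hn : 1 ≤ n) (h : IsPrimitiveRoot ζ n) (a b : ℕ) :
    (n.choose a * (n - a).choose b : ℕ) * altMoment ζ n a b =
      n.factorial * coeff (Finsupp.single (0 : Fin 2) a + Finsupp.single 1 b)
        (∑ j ∈ range (n + 1),
          monomial (Finsupp.single (0 : Fin 2) j + Finsupp.single 1 j) (lucasCoeff n j : ℂ) -
        monomial (Finsupp.single 0 n) ((-1) ^ n) - monomial (Finsupp.single 1 n) ((-1) ^ n)) := by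
  rw [← prod_one_add_root_add_inv_X hn h, ← coeff_C_mul, map_natCast, factorial_mul_prod,
    coeff_sum, altMoment, mul_sum]
  refine sum_congr rfl fun U _ => ?_
  have h1 : (-1 : MvPolynomial (Fin 2) ℂ) ^ #U = C ((-1) ^ #U) := by simp
  rw [sum_add_distrib, sum_add_distrib, ← sum_mul, ← sum_mul, ← map_sum, ← map_sum, ← map_sum,
    h1, coeff_C_mul, coeff_trinomial_pow]
  simp only [sum_const, nsmul_eq_mul, mul_one]
  ring

theorem choose_mul_altMoment_self {ζ : ℂ} {n : ℕ} (hn : 1 ≤ n) (h : IsPrimitiveRoot ζ n) (j : ℕ) :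
    (n.choose (2 * j) : ℂ) * altMoment ζ n j j =
      n.factorial * (lucasCoeff n j / (2 * j).choose j : ℝ) := by
  have hc := choose_mul_altMoment hn h j j
  -- Regrouping isolates `n.choose (2 * j)`, the weight in the matrix binomial expansion. Keeping it
  -- undivided covers `2 * j > n` too.
  have hch : n.choose j * (n - j).choose j = n.choose (2 * j) * (2 * j).choose j := by
    by_cases hj : 2 * j ≤ n
    · rw [Nat.choose_mul (by omega), show 2 * j - j = j by omega]
    · rw [Nat.choose_eq_zero_of_lt (show n < 2 * j by omega),
        Nat.choose_eq_zero_of_lt (show n - j < j by omega)]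
      simp
  have hne : ((2 * j).choose j : ℂ) ≠ 0 := by
    exact_mod_cast (Nat.choose_pos (show j ≤ 2 * j by omega)).ne'
  have hinj (m : ℕ) : (Finsupp.single (0 : Fin 2) m + Finsupp.single 1 m =
      Finsupp.single (0 : Fin 2) j + Finsupp.single 1 j) ↔ j = m := by
    refine ⟨fun h => ?_, by rintro rfl; rfl⟩
    have h0 := DFunLike.congr_fun h 0
    simp at h0
    exact h0.symm
  have hn0 : Finsupp.single (0 : Fin 2) n ≠ Finsupp.single (0 : Fin 2) j + Finsupp.single 1 j := by
    intro h
    have h0 := DFunLike.congr_fun h 0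
    have h1 := DFunLike.congr_fun h 1
    simp at h0 h1
    omega
  have hn1 : Finsupp.single (1 : Fin 2) n ≠ Finsupp.single (0 : Fin 2) j + Finsupp.single 1 j := by
    intro h
    have h0 := DFunLike.congr_fun h 0
    have h1 := DFunLike.congr_fun h 1
    simp at h0 h1
    omega
  simp only [MvPolynomial.coeff_sub, MvPolynomial.coeff_sum, MvPolynomial.coeff_monomial, hinj,
    if_neg hn0, if_neg hn1, sum_ite_eq, mem_range, sub_zero] at hc
  have hl : (if j < n + 1 then (lucasCoeff n j : ℂ) else 0) = lucasCoeff n j := by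
    split_ifs with hj
    · rfl
    · rw [lucasCoeff_of_lt (by omega)]; simp
  rw [hl, hch] at hc
  push_cast at hc ⊢
  field_simp
  linear_combination hc

/-- The monomial `x ^ (j+1) y ^ j` is off the diagonal, and for `n ≥ 2` it is neither `x ^ n` nor `y
^ n`. -/
theorem choose_mul_altMoment_succ {ζ : ℂ} {n : ℕ} (hn : 2 ≤ n) (h : IsPrimitiveRoot ζ n) (j : ℕ) :
    (n.choose (2 * j + 1) : ℂ) * altMoment ζ n (j + 1) j = 0 := by
  have hc := choose_mul_altMoment (by omega) h (j + 1) j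
  have hch : n.choose (j + 1) * (n - (j + 1)).choose j =
      n.choose (2 * j + 1) * (2 * j + 1).choose (j + 1) := by
    by_cases hj : 2 * j + 1 ≤ n
    · rw [Nat.choose_mul (by omega), show 2 * j + 1 - (j + 1) = j by omega]
    · rw [Nat.choose_eq_zero_of_lt (show n < 2 * j + 1 by omega)]
      rcases lt_or_ge n (j + 1) with h' | h'
      · rw [Nat.choose_eq_zero_of_lt h']; simp
      · rw [Nat.choose_eq_zero_of_lt (show n - (j + 1) < j by omega)]; simp
  have hne : ((2 * j + 1).choose (j + 1) : ℂ) ≠ 0 := by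
    exact_mod_cast (Nat.choose_pos (show j + 1 ≤ 2 * j + 1 by omega)).ne'
  have hne' (m l : ℕ) (hm : m ≠ j + 1 ∨ l ≠ j) :
      (Finsupp.single (0 : Fin 2) m + Finsupp.single 1 l ≠
      Finsupp.single (0 : Fin 2) (j + 1) + Finsupp.single 1 j) := by
    intro h
    have h0 := DFunLike.congr_fun h 0
    have h1 := DFunLike.congr_fun h 1
    simp at h0 h1
    omega
  have hn0 := hne' n 0 (by omega)
  have hn1 := hne' 0 n (by omega)
  simp only [Finsupp.single_zero, add_zero, zero_add] at hn0 hn1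
  simp only [MvPolynomial.coeff_sub, MvPolynomial.coeff_sum, MvPolynomial.coeff_monomial,
    if_neg hn0, if_neg hn1, sub_zero] at hc
  rw [sum_eq_zero fun m _ => if_neg (hne' m m (by omega)), mul_zero] at hc
  rw [hch] at hc
  push_cast at hc
  have := mul_eq_zero.1 hc
  simp only [mul_eq_zero, hne, or_false] at this
  exact mul_eq_zero.2 this

/-! ### The finite sum for `-λ(n)` and its recurrence -/

/-- The term with index `j` of the terminating series for `-λ(n)`. -/
noncomputable def lamTerm (n j : ℕ) : ℝ := lucasCoeff n j / (2 * j).choose j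

theorem lamTerm_of_lt {n j : ℕ} (h : n < 2 * j) : lamTerm n j = 0 := by
  rw [lamTerm, lucasCoeff_of_lt h, zero_div]

theorem lamTerm_zero {n : ℕ} (hn : 1 ≤ n) : lamTerm n 0 = 1 := by
  simp [lamTerm, lucasCoeff_zero hn]

theorem lamTerm_eq {j r : ℕ} (h : 1 ≤ 2 * j + r) : lamTerm (2 * j + r) j =
    (-1) ^ j * (2 * j + r) * (j + r - 1).factorial * j.factorial /
      (r.factorial * (2 * j).factorial) := by
  have hc : ((2 * j).choose j : ℝ) * (j.factorial * j.factorial) = (2 * j).factorial := by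
    have := Nat.choose_mul_factorial_mul_factorial (show j ≤ 2 * j by omega)
    rw [show 2 * j - j = j by omega] at this
    rw [← mul_assoc]
    exact_mod_cast this
  have h0 : ((2 * j).choose j : ℝ) ≠ 0 := by
    exact_mod_cast (Nat.choose_pos (show j ≤ 2 * j by omega)).ne'
  have := Nat.factorial_ne_zero j
  have := Nat.factorial_ne_zero r
  rw [lamTerm, lucasCoeff, if_pos (by omega), show 2 * j + r - 1 - j = j + r - 1 by omega,
    show 2 * j + r - 2 * j = r by omega, ← hc]
  push_cast
  field_simp

/-- A creative-telescoping relation: with `G(j) = 2 (2j - 1) lamTerm (n+1) j` it says `G(j+1) - G(j)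
= (n+1) lamTerm n j - 2n lamTerm (n+1) j`. -/
theorem lamTerm_succ_left {n : ℕ} (hn : 1 ≤ n) (j : ℕ) :
    2 * ((n : ℝ) + 1 - 2 * j) * lamTerm (n + 1) j + 2 * (2 * j + 1) * lamTerm (n + 1) (j + 1) =
      (n + 1) * lamTerm n j := by
  rcases lt_or_ge n (2 * j) with h | h
  · rw [lamTerm_of_lt h, lamTerm_of_lt (show n + 1 < 2 * (j + 1) by omega)]
    rcases lt_or_ge (n + 1) (2 * j) with h' | h'
    · rw [lamTerm_of_lt h']; ring
    · have : (n : ℝ) + 1 = 2 * j := by exact_mod_cast (show n + 1 = 2 * j by omega)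
      rw [this]; ring
  obtain ⟨r, rfl⟩ := Nat.exists_eq_add_of_le h
  have h1 := lamTerm_eq hn
  have h2 := lamTerm_eq (j := j) (r := r + 1) (by omega)
  have hj := Nat.factorial_ne_zero j
  have hj2 := Nat.factorial_ne_zero (2 * j)
  have hr := Nat.factorial_ne_zero r
  rcases r with _ | r
  · obtain ⟨i, rfl⟩ := Nat.exists_eq_add_of_le' (show 1 ≤ j by omega)
    rw [lamTerm_of_lt (show 2 * (i + 1) + 0 + 1 < 2 * (i + 1 + 1) by omega)]
    rw [add_assoc, h1, h2]
    simp only [Nat.factorial_succ, zero_add, add_zero, Nat.add_sub_cancel]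
    have := Nat.factorial_ne_zero i
    push_cast
    field_simp
    ring
  · have h3 := lamTerm_eq (j := j + 1) (r := r) (by omega)
    rw [show 2 * j + (r + 1) + 1 = 2 * (j + 1) + r by ring, h1, h3,
      show 2 * (j + 1) + r = 2 * j + (r + 1 + 1) by ring, h2,
      show j + (r + 1) - 1 = j + r by omega, show j + (r + 1 + 1) - 1 = j + r + 1 by omega,
      show j + 1 + r - 1 = j + r by omega, show 2 * (j + 1) = 2 * j + 1 + 1 by ring]
    simp only [Nat.factorial_succ]
    have := Nat.factorial_ne_zero (j + r)
    have := Nat.factorial_ne_zero r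
    push_cast
    field_simp
    ring

/-- The value `-λ(n)` as a finite sum. -/
noncomputable def lamSum (n : ℕ) : ℝ := ∑ j ∈ range (n + 1), lamTerm n j

theorem lamSum_succ {n : ℕ} (hn : 1 ≤ n) :
    2 * (n : ℝ) * lamSum (n + 1) = (n + 1) * lamSum n - 2 := by
  have h1 : lamSum n = ∑ j ∈ range (n + 2), lamTerm n j := by
    rw [lamSum, sum_range_succ _ (n + 1), lamTerm_of_lt (by omega), add_zero]
  -- The upper boundary term is zero and the lower one is `-2`, the source of the constant in the
  -- recurrence.
  have htel := sum_range_sub (fun j : ℕ => 2 * (2 * (j : ℝ) - 1) * lamTerm (n + 1) j) (n + 2)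
  rw [lamTerm_of_lt (show n + 1 < 2 * (n + 2) by omega), lamTerm_zero (by omega)] at htel
  have h2 : (∑ j ∈ range (n + 2), (2 * (2 * ((j + 1 : ℕ) : ℝ) - 1) * lamTerm (n + 1) (j + 1) -
      2 * (2 * (j : ℝ) - 1) * lamTerm (n + 1) j)) =
      ∑ j ∈ range (n + 2), ((n + 1) * lamTerm n j - 2 * n * lamTerm (n + 1) j) := by
    refine sum_congr rfl fun j _ => ?_
    rw [← lamTerm_succ_left hn j]
    push_cast
    ring
  rw [h2, sum_sub_distrib, ← mul_sum, ← mul_sum, ← h1] at htel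
  have h3 : lamSum (n + 1) = ∑ j ∈ range (n + 2), lamTerm (n + 1) j := rfl
  rw [← h3] at htel
  norm_num at htel
  linarith

/-! ### Identification with the hypergeometric series -/

/-- After scaling by `4 ^ j`, the two Pochhammer symbols supply the alternate factors of `n (n-1) ⋯
(n-2j+1)`. -/
theorem ascPochhammer_eval_neg_half (n j : ℕ) :
    (ascPochhammer ℝ j).eval (-(n : ℝ) / 2 + 1 / 2) * (ascPochhammer ℝ j).eval (-(n : ℝ) / 2) * 4 ^ j
      = n.descFactorial (2 * j) := by
  induction j with
  | zero => simp
  | succ j ih =>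
    rw [ascPochhammer_succ_eval, ascPochhammer_succ_eval, show 2 * (j + 1) = 2 * j + 1 + 1 by ring,
      Nat.descFactorial_succ, Nat.descFactorial_succ]
    rcases lt_or_ge n (2 * j + 1) with h | h
    · have h0 : (n - (2 * j + 1)) * ((n - 2 * j) * n.descFactorial (2 * j)) = 0 := by
        rcases Nat.lt_succ_iff_lt_or_eq.1 h with h | rfl
        · rw [Nat.descFactorial_of_lt h]; simp
        · simp
      rw [h0]
      rcases Nat.lt_succ_iff_lt_or_eq.1 h with h | h
      · rw [Nat.descFactorial_of_lt h] at ih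
        push_cast at ih ⊢
        linear_combination (-(n : ℝ) / 2 + 1 / 2 + j) * (-(n : ℝ) / 2 + j) * 4 * ih
      · have : (n : ℝ) = 2 * j := by exact_mod_cast h
        have h' : -(n : ℝ) / 2 + j = 0 := by rw [this]; ring
        rw [h']
        simp
    · rw [Nat.cast_mul, Nat.cast_mul, ← ih, Nat.cast_sub h, Nat.cast_sub (by omega)]
      push_cast
      ring

theorem ascPochhammer_eval_half (j : ℕ) :
    (ascPochhammer ℝ j).eval (1 / 2) * (4 ^ j * j.factorial) = (2 * j).factorial := by
  induction j with
  | zero => simp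
  | succ j ih =>
    rw [ascPochhammer_succ_eval, show 2 * (j + 1) = 2 * j + 1 + 1 by ring]
    simp only [Nat.factorial_succ]
    push_cast
    rw [← ih]
    ring

theorem ascPochhammer_eval_neg_add_one {n j : ℕ} (h : j < n) :
    (ascPochhammer ℝ j).eval (-(n : ℝ) + 1) * (n - 1 - j).factorial =
      (-1) ^ j * (n - 1).factorial := by
  induction j with
  | zero => simp
  | succ j ih =>
    have := ih (by omega)
    rw [show n - 1 - j = (n - 1 - (j + 1)) + 1 by omega, Nat.factorial_succ] at this
    have hc : ((n - 1 - (j + 1) : ℕ) : ℝ) = n - 1 - (j + 1) := by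
      rw [Nat.cast_sub (by omega), Nat.cast_sub (by omega)]; push_cast; ring
    push_cast at this
    rw [hc] at this
    rw [ascPochhammer_succ_eval]
    linear_combination -this

theorem lam_eq_neg_lamSum {n : ℕ} (hn : 2 ≤ n) : lam n = -lamSum n := by
  rw [lam, hypergeom, lamSum]
  congr 1
  have hdesc (j : ℕ) : (ascPochhammer ℝ j).eval (-(n : ℝ) / 2 + 1 / 2) *
      (ascPochhammer ℝ j).eval (-(n : ℝ) / 2) = n.descFactorial (2 * j) / 4 ^ j := by
    rw [← ascPochhammer_eval_neg_half]; field_simp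
  have hone (j : ℕ) : (ascPochhammer ℝ j).eval 1 = j.factorial := by
    simp
  have hterm (j : ℕ) : ((ascPochhammer ℝ j).eval 1 *
      (ascPochhammer ℝ j).eval (-(n : ℝ) / 2 + 1 / 2) * (ascPochhammer ℝ j).eval (-(n : ℝ) / 2)) /
      ((ascPochhammer ℝ j).eval (1 / 2) * (ascPochhammer ℝ j).eval (-(n : ℝ) + 1)) *
      (1 ^ j / (j.factorial : ℝ)) = lamTerm n j := by
    rw [mul_assoc ((ascPochhammer ℝ j).eval 1), hdesc]
    -- For `2 * j > n` the numerator vanishes, so even where `(-n+1)_j = 0` the quotient is zero by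
    -- the convention `0 / 0 = 0`.
    rcases lt_or_ge n (2 * j) with h | h
    · rw [lamTerm_of_lt h, Nat.descFactorial_of_lt h]
      simp
    · obtain ⟨r, rfl⟩ := Nat.exists_eq_add_of_le h
      have h1 := ascPochhammer_eval_half j
      have h2 := ascPochhammer_eval_neg_add_one (n := 2 * j + r) (j := j) (by omega)
      have h3 := Nat.factorial_mul_descFactorial h
      have hj : (j.factorial : ℝ) ≠ 0 := by exact_mod_cast Nat.factorial_ne_zero j
      have h2j : ((2 * j).factorial : ℝ) ≠ 0 := by exact_mod_cast Nat.factorial_ne_zero _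
      have hr : (r.factorial : ℝ) ≠ 0 := by exact_mod_cast Nat.factorial_ne_zero _
      have hf : ((j + r - 1).factorial : ℝ) ≠ 0 := by exact_mod_cast Nat.factorial_ne_zero _
      have hg : ((2 * j + r - 1).factorial : ℝ) ≠ 0 := by exact_mod_cast Nat.factorial_ne_zero _
      have h4 : (4 : ℝ) ^ j ≠ 0 := by positivity
      rw [show 2 * j + r - 2 * j = r by omega] at h3
      rw [show 2 * j + r - 1 - j = j + r - 1 by omega] at h2
      have h5 : (2 * j + r).factorial = (2 * j + r) * (2 * j + r - 1).factorial :=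
        (Nat.mul_factorial_pred (by omega)).symm
      have h3' : ((2 * j + r).descFactorial (2 * j) : ℝ) =
          (2 * j + r) * (2 * j + r - 1).factorial / r.factorial := by
        rw [eq_div_iff hr]
        rw [h5] at h3
        have : (((2 * j + r).descFactorial (2 * j) * r.factorial : ℕ) : ℝ) =
          ((2 * j + r) * (2 * j + r - 1).factorial : ℕ) := by rw [← h3, mul_comm]
        push_cast at this
        exact this
      rw [hone, h3', eq_div_of_mul_eq hf h2, eq_div_of_mul_eq (mul_ne_zero h4 hj) h1,
        lamTerm_eq (by omega)]
      have hs : ((-1 : ℝ) ^ j) * (-1) ^ j = 1 := by rw [← mul_pow]; simp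
      have hs0 : (-1 : ℝ) ^ j ≠ 0 := by simp
      rw [one_pow]
      field_simp
      linear_combination -(2 * j + r : ℝ) * hs
  rw [tsum_eq_sum (s := range (n + 1))]
  · exact sum_congr rfl fun j _ => hterm j
  · intro j hj
    rw [hterm, lamTerm_of_lt]
    simp at hj
    omega

/-! ### Bounds on `λ(n)` -/

theorem lam_succ {n : ℕ} (hn : 2 ≤ n) : 2 * (n : ℝ) * lam (n + 1) = (n + 1) * lam n + 2 := by
  rw [lam_eq_neg_lamSum hn, lam_eq_neg_lamSum (by omega)]
  linarith [lamSum_succ (show 1 ≤ n by omega)]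

theorem lam_three : lam 3 = 1 / 2 := by
  rw [lam_eq_neg_lamSum (by norm_num), lamSum]
  simp [sum_range_succ, lamTerm, lucasCoeff, Nat.factorial]
  norm_num

theorem lam_nonneg {n : ℕ} (hn : 3 ≤ n) : 0 ≤ lam n := by
  induction n, hn using Nat.le_induction with
  | base => rw [lam_three]; norm_num
  | succ n hn ih =>
    have h := lam_succ (show 2 ≤ n by omega)
    have hpos : (0 : ℝ) < 2 * n := by positivity
    refine nonneg_of_mul_nonneg_right (a := 2 * (n : ℝ)) ?_ hpos
    rw [h]
    positivity

theorem lam_le_one {n : ℕ} (hn : 3 ≤ n) : lam n ≤ 1 := by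
  induction n, hn using Nat.le_induction with
  | base => rw [lam_three]; norm_num
  | succ n hn ih =>
    have h := lam_succ (show 2 ≤ n by omega)
    have hn' : (3 : ℝ) ≤ n := by exact_mod_cast hn
    have hpos : (0 : ℝ) < 2 * n := by positivity
    refine le_of_mul_le_mul_left (a := 2 * (n : ℝ)) ?_ hpos
    rw [h]
    nlinarith

/-- The bound `6` propagates when `6 (n+1) ^ 2 + 2n (n+1) ≤ 12 n ^ 2`, which holds from `n = 4` on
but fails at `n = 3`. -/
theorem lam_mul_le {n : ℕ} (hn : 4 ≤ n) : n * lam n ≤ 6 := by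
  induction n, hn using Nat.le_induction with
  | base => have := lam_le_one (show 3 ≤ 4 by norm_num); norm_num; linarith
  | succ n hn ih =>
    have h := lam_succ (show 2 ≤ n by omega)
    have hn' : (4 : ℝ) ≤ n := by exact_mod_cast hn
    have hpos : (0 : ℝ) < 2 * n * n := by positivity
    refine le_of_mul_le_mul_left (a := 2 * (n : ℝ) * n) ?_ hpos
    have : 2 * (n : ℝ) * n * (((n + 1 : ℕ) : ℝ) * lam (n + 1)) =
        (n + 1) ^ 2 * (n * lam n) + 2 * n * (n + 1) := by
      push_cast
      linear_combination (n : ℝ) * (n + 1) * h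
    rw [this]
    nlinarith [mul_le_mul_of_nonneg_left ih (sq_nonneg ((n : ℝ) + 1))]

theorem lam_isBigO : lam =O[Filter.atTop] (fun n : ℕ => (n : ℝ)⁻¹) := by
  refine Asymptotics.IsBigO.of_bound 6 ?_
  filter_upwards [Filter.eventually_ge_atTop 4] with n hn
  have hpos : (0 : ℝ) < n := by positivity
  rw [Real.norm_of_nonneg (lam_nonneg (by omega)), Real.norm_of_nonneg (by positivity),
    ← div_eq_mul_inv, le_div_iff₀ hpos, mul_comm]
  exact lam_mul_le hn

/-! ### Traceless symmetric matrices and their powers -/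

/-- A symmetric traceless matrix. -/
def tracelessMat (p q : ℝ) : Matrix (Fin 2) (Fin 2) ℝ := !![p, q; q, -p]

theorem tracelessMat_sq (p q : ℝ) : tracelessMat p q ^ 2 = (p ^ 2 + q ^ 2) • 1 := by
  ext i j
  fin_cases i <;> fin_cases j <;>
    simp [tracelessMat, pow_two, Matrix.mul_apply, Fin.sum_univ_two] <;> ring

theorem tracelessMat_zero : tracelessMat 0 0 = 0 := by
  ext i j
  fin_cases i <;> fin_cases j <;> simp [tracelessMat]

theorem sum_tracelessMat {ι : Type*} (s : Finset ι) (p q : ι → ℝ) :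
    ∑ k ∈ s, tracelessMat (p k) (q k) = tracelessMat (∑ k ∈ s, p k) (∑ k ∈ s, q k) := by
  ext i j
  rw [Matrix.sum_apply]
  fin_cases i <;> fin_cases j <;> simp [tracelessMat]

theorem smul_tracelessMat (c p q : ℝ) :
    c • tracelessMat p q = tracelessMat (c * p) (c * q) := by
  ext i j
  fin_cases i <;> fin_cases j <;> simp [tracelessMat]

theorem two_smul_frameMat (n k : ℕ) : (2 : ℝ) • frameMat n k =
    1 + tracelessMat (Real.cos (2 * (k * (Real.pi / n)))) (Real.sin (2 * (k * (Real.pi / n)))) := by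
  ext i j
  have h := Real.sin_sq_add_cos_sq (k * (Real.pi / n))
  fin_cases i <;> fin_cases j <;>
    simp [tracelessMat, frameMat, frameVec, Real.cos_two_mul,
      Real.sin_two_mul] <;> linarith

theorem sum_range_two_mul {M : Type*} [AddCommMonoid M] (f : ℕ → M) (N : ℕ) :
    ∑ m ∈ range (2 * N), f m = ∑ j ∈ range N, (f (2 * j) + f (2 * j + 1)) := by
  induction N with
  | zero => simp
  | succ N ih =>
    rw [show 2 * (N + 1) = 2 * N + 1 + 1 by ring, sum_range_succ, sum_range_succ, ih,
      sum_range_succ, add_assoc]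

theorem smul_one_add_tracelessMat_pow (z p q : ℝ) (n : ℕ) :
    (z • 1 + tracelessMat p q) ^ n =
      (∑ j ∈ range (n + 1), n.choose (2 * j) * (z ^ (n - 2 * j) * (p ^ 2 + q ^ 2) ^ j)) • 1 +
      (∑ j ∈ range (n + 1), n.choose (2 * j + 1) * (z ^ (n - (2 * j + 1)) * (p ^ 2 + q ^ 2) ^ j)) •
        tracelessMat p q := by
  have hcomm : Commute (tracelessMat p q) (z • 1) := (Commute.one_right _).smul_right z
  rw [add_comm (z • 1), hcomm.add_pow]
  -- Zero binomials pad the range to even length, so it splits into pairs `2j`, `2j + 1`.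
  have hext : ∑ m ∈ range (n + 1), tracelessMat p q ^ m * (z • 1) ^ (n - m) *
        (n.choose m : Matrix (Fin 2) (Fin 2) ℝ) =
      ∑ m ∈ range (2 * (n + 1)), (n.choose m * z ^ (n - m)) • tracelessMat p q ^ m := by
    symm
    rw [← sum_subset (range_subset_range.2 (show n + 1 ≤ 2 * (n + 1) by omega))]
    · refine sum_congr rfl fun m _ => ?_
      rw [smul_pow, one_pow, mul_smul_comm, mul_one, ← nsmul_eq_mul',
        ← Nat.cast_smul_eq_nsmul ℝ, smul_smul]
    · intro m _ hm
      rw [Nat.choose_eq_zero_of_lt (by simpa using hm)]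
      simp
  rw [hext, sum_range_two_mul, sum_add_distrib, sum_smul, sum_smul]
  congr 1
  · refine sum_congr rfl fun j _ => ?_
    rw [pow_mul, tracelessMat_sq, smul_pow, one_pow, smul_smul, mul_assoc]
  · refine sum_congr rfl fun j _ => ?_
    rw [pow_succ, pow_mul, tracelessMat_sq, smul_pow, one_pow, smul_mul_assoc, one_mul, smul_smul,
      mul_assoc]

/-! ### Real form of the alternating moments -/

/-- The first coordinate of the sum of the doubled frame directions outside `U`. -/
noncomputable def partialCos (n : ℕ) (U : Finset (Fin n)) : ℝ :=
  ∑ k ∈ Uᶜ, Real.cos (2 * (((k : ℕ) + 1 : ℕ) * (Real.pi / n)))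

/-- The second coordinate of the sum of the doubled frame directions outside `U`. -/
noncomputable def partialSin (n : ℕ) (U : Finset (Fin n)) : ℝ :=
  ∑ k ∈ Uᶜ, Real.sin (2 * (((k : ℕ) + 1 : ℕ) * (Real.pi / n)))

theorem exp_pow_eq (n k : ℕ) : Complex.exp (2 * Real.pi * Complex.I / n) ^ k =
    (Real.cos (2 * (k * (Real.pi / n))) : ℂ) + Real.sin (2 * (k * (Real.pi / n))) * Complex.I := by
  rw [← Complex.exp_nat_mul, Complex.ofReal_cos, Complex.ofReal_sin, ← Complex.exp_mul_I]
  congr 1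
  push_cast
  ring

theorem exp_inv_pow_eq (n k : ℕ) : (Complex.exp (2 * Real.pi * Complex.I / n))⁻¹ ^ k =
    (Real.cos (2 * (k * (Real.pi / n))) : ℂ) - Real.sin (2 * (k * (Real.pi / n))) * Complex.I := by
  rw [← Complex.exp_neg, ← Complex.exp_nat_mul, sub_eq_add_neg, ← neg_mul, ← Complex.ofReal_neg,
    ← Real.sin_neg, ← Real.cos_neg, Complex.ofReal_cos, Complex.ofReal_sin, ← Complex.exp_mul_I]
  congr 1
  push_cast
  ring

theorem sum_exp_pow {n : ℕ} (U : Finset (Fin n)) :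
    ∑ k ∈ Uᶜ, Complex.exp (2 * Real.pi * Complex.I / n) ^ ((k : ℕ) + 1) =
      partialCos n U + partialSin n U * Complex.I := by
  simp_rw [exp_pow_eq]
  rw [sum_add_distrib, ← sum_mul, partialCos, partialSin]
  push_cast
  rfl

theorem sum_exp_inv_pow {n : ℕ} (U : Finset (Fin n)) :
    ∑ k ∈ Uᶜ, (Complex.exp (2 * Real.pi * Complex.I / n))⁻¹ ^ ((k : ℕ) + 1) =
      partialCos n U - partialSin n U * Complex.I := by
  simp_rw [exp_inv_pow_eq]
  rw [sum_sub_distrib, ← sum_mul, partialCos, partialSin]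
  push_cast
  rfl

theorem add_mul_I_pow_mul_sub_mul_I_pow (p q : ℝ) (j : ℕ) :
    ((p : ℂ) + q * Complex.I) ^ j * (p - q * Complex.I) ^ j = ((p ^ 2 + q ^ 2) ^ j : ℝ) := by
  rw [← mul_pow]
  push_cast
  congr 1
  linear_combination -(q : ℂ) ^ 2 * Complex.I_sq

theorem choose_mul_sum_even {n : ℕ} (hn : 1 ≤ n) (j : ℕ) :
    (n.choose (2 * j) : ℝ) * ∑ U : Finset (Fin n), (-1) ^ #U * ((#Uᶜ : ℝ) ^ (n - 2 * j) *
      (partialCos n U ^ 2 + partialSin n U ^ 2) ^ j) = n.factorial * lamTerm n j := by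
  have h := choose_mul_altMoment_self hn (Complex.isPrimitiveRoot_exp n (by omega)) j
  rw [altMoment] at h
  simp_rw [sum_exp_pow, sum_exp_inv_pow, mul_assoc, add_mul_I_pow_mul_sub_mul_I_pow] at h
  rw [Nat.sub_sub, ← two_mul] at h
  rw [lamTerm]
  exact_mod_cast h

/-- Real and imaginary parts of the vanishing moment with exponents `(j + 1, j)`. -/
theorem choose_mul_sum_odd {n : ℕ} (hn : 2 ≤ n) (j : ℕ) :
    (n.choose (2 * j + 1) : ℝ) * ∑ U : Finset (Fin n), (-1) ^ #U * ((#Uᶜ : ℝ) ^ (n - (2 * j + 1)) *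
      (partialCos n U ^ 2 + partialSin n U ^ 2) ^ j * partialCos n U) = 0 ∧
    (n.choose (2 * j + 1) : ℝ) * ∑ U : Finset (Fin n), (-1) ^ #U * ((#Uᶜ : ℝ) ^ (n - (2 * j + 1)) *
      (partialCos n U ^ 2 + partialSin n U ^ 2) ^ j * partialSin n U) = 0 := by
  have h := choose_mul_altMoment_succ hn (Complex.isPrimitiveRoot_exp n (by omega)) j
  rw [altMoment] at h
  simp_rw [sum_exp_pow, sum_exp_inv_pow, pow_succ', mul_assoc, add_mul_I_pow_mul_sub_mul_I_pow] at h
  rw [Nat.sub_sub, show j + 1 + j = 2 * j + 1 by ring] at h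
  have hsplit : ∑ U : Finset (Fin n), (-1) ^ #U * ((#Uᶜ : ℂ) ^ (n - (2 * j + 1)) *
      ((partialCos n U + partialSin n U * Complex.I) *
        (((partialCos n U ^ 2 + partialSin n U ^ 2) ^ j : ℝ) : ℂ))) =
      ((∑ U : Finset (Fin n), (-1) ^ #U * ((#Uᶜ : ℝ) ^ (n - (2 * j + 1)) *
        (partialCos n U ^ 2 + partialSin n U ^ 2) ^ j * partialCos n U) : ℝ) : ℂ) +
      ((∑ U : Finset (Fin n), (-1) ^ #U * ((#Uᶜ : ℝ) ^ (n - (2 * j + 1)) *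
        (partialCos n U ^ 2 + partialSin n U ^ 2) ^ j * partialSin n U) : ℝ) : ℂ) * Complex.I := by
    push_cast
    rw [sum_mul, ← sum_add_distrib]
    exact sum_congr rfl fun U _ => by ring
  rw [hsplit] at h
  have hre := congrArg Complex.re h
  have him := congrArg Complex.im h
  rw [← Complex.ofReal_natCast, Complex.re_ofReal_mul] at hre
  rw [← Complex.ofReal_natCast, Complex.im_ofReal_mul] at him
  simp only [Complex.add_re, Complex.add_im, Complex.ofReal_re, Complex.ofReal_im,
    Complex.re_ofReal_mul, Complex.im_ofReal_mul, Complex.I_re, Complex.I_im, mul_zero, mul_one,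
    add_zero, zero_add, Complex.zero_re, Complex.zero_im] at hre him
  exact ⟨hre, him⟩

/-! ### Symmetrized product, arithmetic mean and norms -/

theorem sum_perm_prod_frameMat {n : ℕ} (hn : 2 ≤ n) :
    ∑ σ : Equiv.Perm (Fin n), (List.ofFn fun i => (2 : ℝ) • frameMat n ((σ i : ℕ) + 1)).prod =
      (n.factorial * lamSum n) • 1 := by
  rw [sum_perm_prod_ofFn fun k : Fin n => (2 : ℝ) • frameMat n ((k : ℕ) + 1)]
  have hU (U : Finset (Fin n)) :
      (-1 : Matrix (Fin 2) (Fin 2) ℝ) ^ #U *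
        (∑ k ∈ Uᶜ, (2 : ℝ) • frameMat n ((k : ℕ) + 1)) ^ n =
      (∑ j ∈ range (n + 1), n.choose (2 * j) * ((-1) ^ #U * ((#Uᶜ : ℝ) ^ (n - 2 * j) *
        (partialCos n U ^ 2 + partialSin n U ^ 2) ^ j))) • 1 +
      tracelessMat
        (∑ j ∈ range (n + 1), n.choose (2 * j + 1) * ((-1) ^ #U * ((#Uᶜ : ℝ) ^ (n - (2 * j + 1)) *
          (partialCos n U ^ 2 + partialSin n U ^ 2) ^ j * partialCos n U)))
        (∑ j ∈ range (n + 1), n.choose (2 * j + 1) * ((-1) ^ #U * ((#Uᶜ : ℝ) ^ (n - (2 * j + 1)) *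
          (partialCos n U ^ 2 + partialSin n U ^ 2) ^ j * partialSin n U))) := by
    have hs : ∑ k ∈ Uᶜ, (2 : ℝ) • frameMat n ((k : ℕ) + 1) =
        (#Uᶜ : ℝ) • 1 + tracelessMat (partialCos n U) (partialSin n U) := by
      simp_rw [two_smul_frameMat]
      rw [sum_add_distrib, sum_tracelessMat, sum_const, Nat.cast_smul_eq_nsmul]
      rfl
    have h1 : (-1 : Matrix (Fin 2) (Fin 2) ℝ) ^ #U = ((-1 : ℝ) ^ #U) • 1 := by
      rw [← one_pow (M := Matrix (Fin 2) (Fin 2) ℝ) #U, ← smul_pow]; simp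
    rw [hs, smul_one_add_tracelessMat_pow, h1, smul_mul_assoc, one_mul, smul_add, smul_smul,
      smul_tracelessMat, smul_tracelessMat]
    simp only [sum_mul, mul_sum]
    congr 2
    · exact sum_congr rfl fun j _ => by ring
    · exact sum_congr rfl fun j _ => by ring
    · exact sum_congr rfl fun j _ => by ring
  simp_rw [hU]
  rw [sum_add_distrib, ← sum_smul, sum_tracelessMat]
  rw [sum_comm, sum_comm (s := (univ : Finset (Finset (Fin n)))) (t := range (n + 1)),
    sum_comm (s := (univ : Finset (Finset (Fin n)))) (t := range (n + 1))]
  simp_rw [← mul_sum]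
  rw [sum_congr rfl fun j _ => choose_mul_sum_even (show 1 ≤ n by omega) j,
    sum_congr rfl fun j _ => (choose_mul_sum_odd hn j).1,
    sum_congr rfl fun j _ => (choose_mul_sum_odd hn j).2, ← mul_sum, sum_const_zero, lamSum]
  rw [tracelessMat_zero, add_zero]

theorem symmGeomMean_eq {n : ℕ} (hn : 2 ≤ n) :
    symmGeomMean n = (-lam n * ((2 : ℝ) ^ n)⁻¹) • (1 : Matrix (Fin 2) (Fin 2) ℝ) := by
  have h := sum_perm_prod_frameMat hn
  have hsm (σ : Equiv.Perm (Fin n)) :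
      (List.ofFn fun i => (2 : ℝ) • frameMat n ((σ i : ℕ) + 1)).prod =
        (2 : ℝ) ^ n • (List.ofFn fun i => frameMat n ((σ i : ℕ) + 1)).prod := by
    have := (MultilinearMap.mkPiAlgebraFin ℝ n (Matrix (Fin 2) (Fin 2) ℝ)).map_smul_univ
      (fun _ => (2 : ℝ)) (fun i => frameMat n ((σ i : ℕ) + 1))
    simpa only [MultilinearMap.mkPiAlgebraFin_apply, prod_const, card_univ, Fintype.card_fin]
      using this
  simp_rw [hsm] at h
  rw [← smul_sum] at h
  have h2 : (2 : ℝ) ^ n ≠ 0 := by positivity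
  have hf : (n.factorial : ℝ) ≠ 0 := by positivity
  rw [symmGeomMean, (eq_inv_smul_iff₀ h2).2 h, smul_smul, smul_smul, lam_eq_neg_lamSum hn]
  congr 1
  field_simp

theorem arithMean_eq {n : ℕ} (hn : 2 ≤ n) :
    arithMean n = (1 / 2 : ℝ) • (1 : Matrix (Fin 2) (Fin 2) ℝ) := by
  have hζ := Complex.isPrimitiveRoot_exp n (by omega)
  -- Multiplying the vanishing sum of roots of unity by `ζ` shifts its exponents from `0, …, n-1` to
  -- `1, …, n`.
  have h0 := congrArg (fun x => x * Complex.exp (2 * Real.pi * Complex.I / n))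
    (hζ.geom_sum_eq_zero (by omega))
  simp only [sum_mul, zero_mul, ← pow_succ] at h0
  simp_rw [exp_pow_eq] at h0
  rw [sum_add_distrib, ← sum_mul, ← Complex.ofReal_sum, ← Complex.ofReal_sum] at h0
  have hre := congrArg Complex.re h0
  have him := congrArg Complex.im h0
  simp only [Complex.add_re, Complex.add_im, Complex.ofReal_re, Complex.ofReal_im,
    Complex.re_ofReal_mul, Complex.im_ofReal_mul, Complex.I_re, Complex.I_im, mul_zero, mul_one,
    add_zero, zero_add, Complex.zero_re, Complex.zero_im] at hre him
  have hsum : (2 : ℝ) • ∑ k ∈ Icc 1 n, frameMat n k = (n : ℝ) • 1 := by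
    have hI : Icc 1 n = (range n).image (· + 1) := by
      ext k
      simp only [mem_Icc, mem_image, mem_range]
      exact ⟨fun h => ⟨k - 1, by omega, by omega⟩, by rintro ⟨a, h, rfl⟩; omega⟩
    rw [hI, sum_image (fun a _ b _ h => Nat.succ_injective h), smul_sum]
    simp_rw [two_smul_frameMat]
    rw [sum_add_distrib, sum_tracelessMat, hre, him, tracelessMat_zero, add_zero, sum_const,
      card_range, Nat.cast_smul_eq_nsmul]
  have hn0 : (n : ℝ) ≠ 0 := by positivity
  rw [arithMean, (eq_inv_smul_iff₀ two_ne_zero).2 hsum, smul_smul, smul_smul]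
  congr 1
  field_simp

theorem opNorm_smul_one (c : ℝ) : opNorm (c • 1) = |c| := by
  rw [opNorm, map_smul, map_one, norm_smul, norm_one, mul_one, Real.norm_eq_abs]

theorem opNorm_symmGeomMean {n : ℕ} (hn : 3 ≤ n) :
    opNorm (symmGeomMean n) = lam n * ((2 : ℝ) ^ n)⁻¹ := by
  rw [symmGeomMean_eq (by omega), opNorm_smul_one, neg_mul, abs_neg, abs_of_nonneg]
  exact mul_nonneg (lam_nonneg hn) (by positivity)

theorem opNorm_arithMean_pow {n : ℕ} (hn : 2 ≤ n) :
    opNorm (arithMean n ^ n) = ((2 : ℝ) ^ n)⁻¹ := by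
  rw [arithMean_eq hn, smul_pow, one_pow, opNorm_smul_one, abs_of_nonneg (by positivity)]
  simp

end HarmonicFrame

theorem mainTheorem2 :
    (∀ n : ℕ, 3 ≤ n →
      HarmonicFrame.symmGeomMean n =
          (-HarmonicFrame.lam n * ((2 : ℝ) ^ n)⁻¹) • (1 : Matrix (Fin 2) (Fin 2) ℝ) ∧
        0 ≤ HarmonicFrame.lam n ∧ HarmonicFrame.lam n ≤ 1 ∧
        HarmonicFrame.opNorm (HarmonicFrame.symmGeomMean n) ≤
          HarmonicFrame.opNorm (HarmonicFrame.arithMean n ^ n)) ∧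
    HarmonicFrame.lam =O[Filter.atTop] (fun n : ℕ => (n : ℝ)⁻¹) ∧
    (fun n : ℕ => HarmonicFrame.opNorm (HarmonicFrame.symmGeomMean n)) =O[Filter.atTop]
      (fun n : ℕ => (n : ℝ)⁻¹ * HarmonicFrame.opNorm (HarmonicFrame.arithMean n ^ n)) := by
  refine ⟨fun n hn => ⟨HarmonicFrame.symmGeomMean_eq (by omega), HarmonicFrame.lam_nonneg hn,
    HarmonicFrame.lam_le_one hn, ?_⟩, HarmonicFrame.lam_isBigO, ?_⟩
  · rw [HarmonicFrame.opNorm_symmGeomMean hn, HarmonicFrame.opNorm_arithMean_pow (by omega)]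
    exact mul_le_of_le_one_left (by positivity) (HarmonicFrame.lam_le_one hn)
  · refine (HarmonicFrame.lam_isBigO.mul
      (Asymptotics.isBigO_refl (fun n : ℕ => ((2 : ℝ) ^ n)⁻¹) Filter.atTop)).congr' ?_ ?_
    · filter_upwards [Filter.eventually_ge_atTop 3] with n hn
      exact (HarmonicFrame.opNorm_symmGeomMean hn).symm
    · filter_upwards [Filter.eventually_ge_atTop 3] with n hn
      rw [HarmonicFrame.opNorm_arithMean_pow (by omega)]
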